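/- For $A\in\mathbb C^{n\times n}$ let $DW(A)=\{(x^*Ax,\|Ax\|^2): x\in\mathbb C^n,\ \|x\|=1\}\subset\mathbb C\times\mathbb R$ be its Davis–Wielandt shell (Euclidean norm). A real rational transfer matrix is called stable if all its entries are proper and have no pole in the closed right half-plane. Let $Y_{C,1},\dots,Y_{C,N}$ be stable real rational $2\times 2$ transfer matrices (the admittances of $N$ converters), let $Y_C^N=\operatorname{diag}(Y_{C,1},\dots,Y_{C,N})$, and let $Y_{\rm grid}$ (the admittance of the network) be an invertible real rational $2N\times 2N$ transfer matrix such that $Y_{\rm grid}^{-1}$ is stable and $Y_{\rm grid}$ has no pole on the imaginary axis. Suppose that the feedback loop of $Y_{\rm grid}^{-1}$ and $\tau Y_C^N$ is well posed for each $\tau\in(0,1]$, that is, $\det\bigl(I+\tau\, Y_{\rm grid}^{-1}(\infty)\,Y_C^N(\infty)\bigr)\neq 0$ (this holds automatically if $Y_{\rm grid}^{-1}$ or $Y_C^N$ is strictly proper). (Separation of DW shells.) If for each $\omega\in[0,\infty)$ and each $\tau\in(0,1]$ $$DW\bigl(Y_C^N(j\omega)\bigr)\cap DW\bigl(-\tfrac1\tau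 Y_{\rm grid}(j\omega)\bigr)=\emptyset ,$$ then the closed-loop multi-converter system, i.e. the negative feedback interconnection $v+Y_{\rm grid}^{-1}i=d_1$, $i-Y_C^N v=d_2$, is (internally) stable: $\det(I+Y_{\rm grid}^{-1}Y_C^N)$ is not identically zero, all closed-loop transfer functions from $(d_1,d_2)$ to $(v,i)$ are proper and have no pole in the closed right half-plane, and the characteristic equation $\det\bigl(I+Y_{\rm grid}^{-1}(s)Y_C^N(s)\bigr)=0$ has no solution with $\operatorname{Re}s\ge 0$. -/

import Mathlib

noncomputable section

namespace Feedback

/-- The Davis-Wielandt shell of a square complex matrix,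
`{(x* A x, ‖A x‖²) : ‖x‖ = 1}`, with the Euclidean norm. -/
def dwShell {n : Type*} [Fintype n] (A : Matrix n n ℂ) : Set (ℂ × ℝ) :=
  {p | ∃ x : n → ℂ, ‖WithLp.toLp 2 x‖ = 1 ∧
    p = (dotProduct (star x) (A.mulVec x), ‖WithLp.toLp 2 (A.mulVec x)‖ ^ 2)}

/-- `s` is a pole of the real rational function `f` (`num` and `denom` are coprime). -/
def IsPole (f : RatFunc ℝ) (s : ℂ) : Prop :=
  f.denom.eval₂ (algebraMap ℝ ℂ) s = 0

/-- A real rational function is proper if it is bounded at infinity. -/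
def IsProper (f : RatFunc ℝ) : Prop :=
  f.num.natDegree ≤ f.denom.natDegree

/-- The value `f(∞)` of a proper real rational function. -/
def valueAtInfinity (f : RatFunc ℝ) : ℝ :=
  f.num.coeff f.denom.natDegree / f.denom.leadingCoeff

/-- The value `M(s)` of a real rational matrix at a point that is not a pole of its entries. -/
def evalAt {m n : Type*} (M : Matrix m n (RatFunc ℝ)) (s : ℂ) : Matrix m n ℂ :=
  M.map (RatFunc.eval (algebraMap ℝ ℂ) s)

/-- The value `M(∞)` of a proper real rational matrix. -/
def evalAtInfinity {m n : Type*} (M : Matrix m n (RatFunc ℝ)) : Matrix m n ℝ :=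
  M.map valueAtInfinity

/-- A real rational transfer matrix is stable (belongs to `RH∞`): every entry is proper and has
no pole in the closed right half-plane. -/
def IsStable {m n : Type*} (M : Matrix m n (RatFunc ℝ)) : Prop :=
  ∀ i j, IsProper (M i j) ∧ ∀ s : ℂ, 0 ≤ s.re → ¬ IsPole (M i j) s

/-- The matrix of the loop equations `v + Z i = d₁`, `i - C v = d₂`. Its determinant is
`det (I + Z C)`. -/
def loopMatrix {n : Type*} [DecidableEq n] (Z C : Matrix n n (RatFunc ℝ)) :
    Matrix (n ⊕ n) (n ⊕ n) (RatFunc ℝ) :=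
  Matrix.fromBlocks 1 Z (-C) 1

/-- (Internal) stability of the negative feedback loop of `Z` and `C`: the loop equations are
uniquely solvable, all closed-loop transfer functions from `(d₁, d₂)` to `(v, i)` are proper and
without poles in the closed right half-plane, and the characteristic equation
`det (I + Z(s) C(s)) = 0` has no solution in the closed right half-plane. -/
structure ClosedLoopStable {n : Type*} [Fintype n] [DecidableEq n]
    (Z C : Matrix n n (RatFunc ℝ)) : Prop where
  solvable : (loopMatrix Z C).det ≠ 0
  stable : IsStable (loopMatrix Z C)⁻¹
  characteristic : ∀ s : ℂ, 0 ≤ s.re → (1 + evalAt Z s * evalAt C s).det ≠ 0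

end Feedback

end

/-! A unit null vector of `C + Y/τ` at `s = jω` would give a common point of the two shells.
Separation therefore makes `C + Y/τ` invertible, and so is `1 + τ Z C = τ Z (C + Y/τ)`, where `Z =
Y⁻¹`.

The determinant of `1 + τ Z C` is a polynomial in `τ` over `RH∞`, equal to `1` at `τ = 0`. Clearing
a common denominator (`eval_ne_zero_of_homotopy`) turns it into a path of real polynomials.
Well-posedness keeps their degree constant and separation keeps their roots off the imaginary axis,
so no root reaches the right half-plane (`aeval_ne_zero_of_path`). This uses connectedness of `[0,
1]` in place of a Nyquist count.

At `τ = 1` the determinant is then a unit of `RH∞` (`isUnit_of_eval_ne_zero`), so the loop matrix is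
invertible over `RH∞`, which is internal stability. -/

open Polynomial

namespace Feedback

/-! ### Roots of a path of real polynomials -/

section Roots

/-- A complex polynomial without roots in the open right half-plane is bounded below there. -/
theorem norm_leadingCoeff_mul_pow_le_norm_eval (p : ℂ[X])
    (hp : ∀ r ∈ p.roots, r.re ≤ 0) {z : ℂ} (hz : 0 < z.re) :
    ‖p.leadingCoeff‖ * z.re ^ p.natDegree ≤ ‖p.eval z‖ := by
  -- Factor by factor: a root in the closed left half-plane is at distance at least `z.re` from `z`.
  have key : ∀ m : Multiset ℂ, (∀ r ∈ m, r.re ≤ 0) →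
      z.re ^ m.card ≤ ‖(m.map (fun r => z - r)).prod‖ := by
    intro m
    induction m using Multiset.induction with
    | empty => simp
    | cons a m ih =>
      intro h
      have h1 := ih fun r hr => h r (Multiset.mem_cons_of_mem hr)
      have h2 : z.re ≤ ‖z - a‖ := by
        have h3 := Complex.re_le_norm (z - a)
        have h4 := h a (Multiset.mem_cons_self a m)
        rw [Complex.sub_re] at h3
        linarith
      rw [Multiset.card_cons, pow_succ', Multiset.map_cons, Multiset.prod_cons, norm_mul]
      exact mul_le_mul h2 h1 (by positivity) (by positivity)
  have hs := IsAlgClosed.splits p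
  rw [hs.eval_eq_prod_roots, norm_mul, hs.natDegree_eq_card_roots]
  exact mul_le_mul_of_nonneg_left (key _ hp) (norm_nonneg _)

/-- Along a continuous path of real polynomials of constant degree without roots on the imaginary
axis, no root enters the closed right half-plane. -/
theorem aeval_ne_zero_of_path (P : ℝ → ℝ[X]) (d : ℕ)
    (hdeg : ∀ τ ∈ Set.Icc (0 : ℝ) 1, (P τ).natDegree = d)
    (hcont : ∀ k, Continuous fun τ => (P τ).coeff k)
    (haxis : ∀ τ ∈ Set.Icc (0 : ℝ) 1, ∀ z : ℂ, z.re = 0 → aeval z (P τ) ≠ 0)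
    (hzero : ∀ z : ℂ, 0 ≤ z.re → aeval z (P 0) ≠ 0) :
    ∀ τ ∈ Set.Icc (0 : ℝ) 1, ∀ z : ℂ, 0 ≤ z.re → aeval z (P τ) ≠ 0 := by
  -- A sum of fixed length is jointly continuous in `(τ, z)`; it agrees with evaluation of `P τ` on
  -- `[0, 1]`, where the degree is `d`.
  set g : ℝ → ℂ → ℂ := fun τ z => ∑ k ∈ Finset.range (d + 1), ((P τ).coeff k : ℂ) * z ^ k with hg
  have hgP : ∀ τ ∈ Set.Icc (0 : ℝ) 1, ∀ z, g τ z = aeval z (P τ) := by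
    intro τ hτ z
    rw [aeval_eq_sum_range, hdeg τ hτ]
    simp [hg, Algebra.smul_def]
  have hgc : Continuous fun p : ℝ × ℂ => g p.1 p.2 := by
    refine continuous_finsetSum _ fun k _ => ?_
    exact (Complex.continuous_ofReal.comp ((hcont k).comp continuous_fst)).mul
      (continuous_snd.pow k)
  have hP0 : ∀ τ ∈ Set.Icc (0 : ℝ) 1, P τ ≠ 0 := by
    intro τ hτ h
    exact haxis τ hτ 0 (by simp) (by simp [h])
  have hlead : ∀ τ ∈ Set.Icc (0 : ℝ) 1, (P τ).coeff d ≠ 0 := by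
    intro τ hτ
    rw [← hdeg τ hτ]
    exact leadingCoeff_ne_zero.2 (hP0 τ hτ)
  obtain ⟨R, hR⟩ : ∃ R : ℝ, ∀ τ ∈ Set.Icc (0 : ℝ) 1, ∀ z : ℂ, aeval z (P τ) = 0 → ‖z‖ ≤ R := by
    -- The Cauchy bound with its supremum enlarged to a sum: continuous in `τ`, hence bounded on
    -- `[0, 1]`.
    have hb : ContinuousOn (fun τ => (∑ k ∈ Finset.range d, ‖(P τ).coeff k‖₊) /
        ‖(P τ).coeff d‖₊ + 1) (Set.Icc (0 : ℝ) 1) := by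
      refine ContinuousOn.add (ContinuousOn.div ?_ ?_ ?_) continuousOn_const
      · exact (continuous_finsetSum _ fun k _ => (hcont k).nnnorm).continuousOn
      · exact (hcont d).nnnorm.continuousOn
      · intro τ hτ
        simpa using hlead τ hτ
    obtain ⟨R, hR⟩ := (isCompact_Icc.image_of_continuousOn hb).bddAbove
    refine ⟨R, fun τ hτ z hz => ?_⟩
    set p := (P τ).map (algebraMap ℝ ℂ)
    have hp : p ≠ 0 := (Polynomial.map_ne_zero_iff (algebraMap ℝ ℂ).injective).2 (hP0 τ hτ)
    have h1 : ‖z‖₊ < p.cauchyBound :=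
      IsRoot.norm_lt_cauchyBound hp (by rwa [IsRoot, eval_map_algebraMap])
    have h2 : p.cauchyBound ≤ R := by
      refine le_trans ?_ (hR ⟨τ, hτ, rfl⟩)
      have hd : p.natDegree = d := by rw [natDegree_map, hdeg τ hτ]
      have hc : ∀ k, ‖p.coeff k‖₊ = ‖(P τ).coeff k‖₊ := by
        intro k
        rw [coeff_map]
        exact nnnorm_algebraMap' ℂ _
      rw [cauchyBound, leadingCoeff, hd, hc]
      refine NNReal.coe_le_coe.2 (add_le_add_left (div_le_div_of_nonneg_right ?_ zero_le) 1)
      refine Finset.sup_le fun k hk => ?_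
      rw [hc]
      exact Finset.single_le_sum (f := fun k => ‖(P τ).coeff k‖₊) (fun _ _ => zero_le) hk
    exact_mod_cast (h1.le.trans h2)
  set K : Set (ℝ × ℂ) :=
    (Set.Icc (0 : ℝ) 1 ×ˢ Metric.closedBall (0 : ℂ) R) ∩ {p | 0 ≤ p.2.re ∧ g p.1 p.2 = 0}
  have hK : IsCompact K := by
    refine (isCompact_Icc.prod (isCompact_closedBall _ _)).inter_right ?_
    exact (isClosed_le continuous_const (Complex.continuous_re.comp continuous_snd)).inter
      (isClosed_eq hgc continuous_const)
  have ht : IsClosed (Prod.fst '' K) := (hK.image continuous_fst).isClosed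
  -- A closed condition that holds whenever `P τ` has no root in the closed right half-plane. The
  -- projection of `K` consists of the remaining `τ` in `[0, 1]`, and is closed by compactness.
  set t' : Set ℝ := {τ | ∀ z : ℂ, 0 < z.re → ‖(P τ).coeff d‖ * z.re ^ d ≤ ‖g τ z‖}
  have ht' : IsClosed t' := by
    simp only [t', Set.ofPred_forall]
    refine isClosed_iInter fun z => isClosed_iInter fun _ => ?_
    exact isClosed_le ((hcont d).norm.mul continuous_const)
      (hgc.comp (Continuous.prodMk continuous_id continuous_const)).norm
  have hmem : ∀ τ ∈ Set.Icc (0 : ℝ) 1, (∀ z : ℂ, 0 ≤ z.re → aeval z (P τ) ≠ 0) → τ ∈ t' := by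
    intro τ hτ h z hz
    have h1 := norm_leadingCoeff_mul_pow_le_norm_eval ((P τ).map (algebraMap ℝ ℂ)) (by
      intro r hr
      by_contra hneg
      refine h r (by linarith) ?_
      rw [← eval_map_algebraMap]
      exact (mem_roots'.1 hr).2) hz
    rw [hgP τ hτ]
    rwa [leadingCoeff_map, natDegree_map, eval_map_algebraMap, norm_algebraMap', leadingCoeff,
      hdeg τ hτ] at h1
  intro τ hτ z hz hroot
  have hmemK : ∀ τ ∈ Set.Icc (0 : ℝ) 1, ∀ z : ℂ, 0 ≤ z.re → aeval z (P τ) = 0 →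
      τ ∈ Prod.fst '' K := by
    intro τ hτ z hz hroot
    refine ⟨(τ, z), ⟨⟨hτ, ?_⟩, hz, ?_⟩, rfl⟩
    · simpa using hR τ hτ z hroot
    · rw [hgP τ hτ, hroot]
  -- If both closed sets met `[0, 1]`, connectedness would give a common `τ`; its root is off the
  -- axis, so `z.re > 0` and the lower bound fails there.
  obtain ⟨σ, hσ, ⟨⟨σ', w⟩, ⟨_, hw, hw0⟩, rfl⟩, hσ'⟩ :=
    isPreconnected_closed_iff.1 (isPreconnected_Icc (a := (0 : ℝ)) (b := 1)) _ _ ht ht'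
      (fun σ hσ => by
        by_cases h : ∀ z : ℂ, 0 ≤ z.re → aeval z (P σ) ≠ 0
        · exact Or.inr (hmem σ hσ h)
        · push Not at h
          obtain ⟨w, hw, hw0⟩ := h
          exact Or.inl (hmemK σ hσ w hw hw0))
      ⟨τ, hτ, hmemK τ hτ z hz hroot⟩
      ⟨0, by simp, hmem 0 (by simp) hzero⟩
  have hw' : 0 < w.re := by
    refine lt_of_le_of_ne hw fun h => haxis _ hσ w h.symm ?_
    rw [← hgP _ hσ]
    exact hw0
  have h1 := hσ' w hw'
  have h2 : 0 < ‖(P σ').coeff d‖ * w.re ^ d :=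
    mul_pos (norm_pos_iff.2 (hlead σ' hσ)) (pow_pos hw' d)
  simp only at hw0
  rw [hw0, norm_zero] at h1
  linarith

end Roots

/-! ### The ring `RH∞`, its evaluations and the homotopy principle -/

section Rational

/-- The real rational functions without a pole at `s`. -/
noncomputable def regularAt (s : ℂ) : Subalgebra ℝ (RatFunc ℝ) where
  carrier := {f | ¬ IsPole f s}
  mul_mem' {f g} hf hg h := by
    have := eval₂_eq_zero_of_dvd_of_eval₂_eq_zero (algebraMap ℝ ℂ) s (RatFunc.denom_mul_dvd f g) h
    rw [eval₂_mul, mul_eq_zero] at this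
    exact this.elim hf hg
  add_mem' {f g} hf hg h := by
    have := eval₂_eq_zero_of_dvd_of_eval₂_eq_zero (algebraMap ℝ ℂ) s (RatFunc.denom_add_dvd f g) h
    rw [eval₂_mul, mul_eq_zero] at this
    exact this.elim hf hg
  algebraMap_mem' r := by
    change ¬ _ = _
    rw [RatFunc.algebraMap_eq_C, RatFunc.denom_C]
    simp

/-- Evaluation at `s` of the rational functions without a pole at `s`. -/
noncomputable def regularEval (s : ℂ) : regularAt s →ₐ[ℝ] ℂ where
  toFun f := RatFunc.eval (algebraMap ℝ ℂ) s f
  map_one' := RatFunc.eval_one _ _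
  map_zero' := RatFunc.eval_zero _ _
  map_mul' f g := RatFunc.eval_mul _ _ f.2 g.2
  map_add' f g := RatFunc.eval_add _ _ f.2 g.2
  commutes' r := by
    change RatFunc.eval _ _ (algebraMap ℝ (RatFunc ℝ) r) = _
    rw [RatFunc.algebraMap_eq_C, RatFunc.eval_C]

/-- Transfers degrees, leading coefficients and values from the reduced fraction to an arbitrary
one. -/
theorem num_mul_eq_mul_denom {f : RatFunc ℝ} {p q : ℝ[X]} (hq : q ≠ 0)
    (hf : f = algebraMap _ _ p / algebraMap _ _ q) : f.num * q = p * f.denom :=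
  (RatFunc.num_mul_eq_mul_denom_iff hq).2 hf

theorem isProper_of_eq_div {f : RatFunc ℝ} {p q : ℝ[X]} (hq : q ≠ 0)
    (hf : f = algebraMap _ _ p / algebraMap _ _ q) (hpq : p.natDegree ≤ q.natDegree) :
    IsProper f := by
  have h := num_mul_eq_mul_denom hq hf
  unfold IsProper
  by_cases hn : f.num = 0
  · simp [hn]
  have hp : p ≠ 0 := by
    rintro rfl
    rw [zero_mul] at h
    exact (mul_ne_zero hn hq) h
  have h2 := congrArg natDegree h
  rw [natDegree_mul hn hq, natDegree_mul hp f.denom_ne_zero] at h2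
  omega

theorem natDegree_le_of_isProper {f : RatFunc ℝ} {p q : ℝ[X]} (hq : q ≠ 0)
    (hf : f = algebraMap _ _ p / algebraMap _ _ q) (hp : IsProper f) :
    p.natDegree ≤ q.natDegree := by
  have h := num_mul_eq_mul_denom hq hf
  unfold IsProper at hp
  by_cases hp0 : p = 0
  · simp [hp0]
  have hn : f.num ≠ 0 := by
    intro h0
    rw [h0, zero_mul] at h
    exact (mul_ne_zero hp0 f.denom_ne_zero) h.symm
  have h2 := congrArg natDegree h
  rw [natDegree_mul hn hq, natDegree_mul hp0 f.denom_ne_zero] at h2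
  omega

theorem valueAtInfinity_of_eq_div {f : RatFunc ℝ} {p q : ℝ[X]} (hq : q ≠ 0)
    (hf : f = algebraMap _ _ p / algebraMap _ _ q) (hpq : p.natDegree ≤ q.natDegree) :
    valueAtInfinity f = p.coeff q.natDegree / q.leadingCoeff := by
  have h := num_mul_eq_mul_denom hq hf
  have hf' : f.num.natDegree ≤ f.denom.natDegree := isProper_of_eq_div hq hf hpq
  have h2 := congrArg (fun r => r.coeff (f.denom.natDegree + q.natDegree)) h
  rw [coeff_mul_add_eq_of_natDegree_le hf' le_rfl, add_comm,
    coeff_mul_add_eq_of_natDegree_le hpq le_rfl] at h2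
  unfold valueAtInfinity
  rw [div_eq_div_iff (leadingCoeff_ne_zero.2 f.denom_ne_zero) (leadingCoeff_ne_zero.2 hq)]
  exact h2

theorem add_eq_div (f g : RatFunc ℝ) :
    f + g = algebraMap _ _ (f.num * g.denom + f.denom * g.num) /
      algebraMap _ _ (f.denom * g.denom) := by
  have hf : algebraMap ℝ[X] (RatFunc ℝ) f.denom ≠ 0 := RatFunc.algebraMap_ne_zero f.denom_ne_zero
  have hg : algebraMap ℝ[X] (RatFunc ℝ) g.denom ≠ 0 := RatFunc.algebraMap_ne_zero g.denom_ne_zero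
  conv_lhs => rw [← f.num_div_denom, ← g.num_div_denom, div_add_div _ _ hf hg]
  simp only [map_add, map_mul]

theorem mul_eq_div (f g : RatFunc ℝ) :
    f * g = algebraMap _ _ (f.num * g.num) / algebraMap _ _ (f.denom * g.denom) := by
  conv_lhs => rw [← f.num_div_denom, ← g.num_div_denom, div_mul_div_comm]
  simp only [map_mul]

theorem natDegree_mul_num_le {f g : RatFunc ℝ} (hf : IsProper f) (hg : IsProper g) :
    (f.num * g.num).natDegree ≤ (f.denom * g.denom).natDegree := by
  rw [natDegree_mul f.denom_ne_zero g.denom_ne_zero]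
  exact natDegree_mul_le_of_le hf hg

theorem natDegree_add_num_le {f g : RatFunc ℝ} (hf : IsProper f) (hg : IsProper g) :
    (f.num * g.denom + f.denom * g.num).natDegree ≤ (f.denom * g.denom).natDegree := by
  rw [natDegree_mul f.denom_ne_zero g.denom_ne_zero]
  exact natDegree_add_le_of_degree_le (natDegree_mul_le_of_le hf (le_refl g.denom.natDegree))
    (natDegree_mul_le_of_le (le_refl f.denom.natDegree) hg)

/-- The proper real rational functions. -/
noncomputable def properRing : Subalgebra ℝ (RatFunc ℝ) where
  carrier := {f | IsProper f}
  mul_mem' {f g} hf hg := isProper_of_eq_div (mul_ne_zero f.denom_ne_zero g.denom_ne_zero)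
    (mul_eq_div f g) (natDegree_mul_num_le hf hg)
  add_mem' {f g} hf hg := isProper_of_eq_div (mul_ne_zero f.denom_ne_zero g.denom_ne_zero)
    (add_eq_div f g) (natDegree_add_num_le hf hg)
  algebraMap_mem' r := by
    change IsProper _
    rw [IsProper, RatFunc.algebraMap_eq_C, RatFunc.num_C]
    simp

/-- Evaluation at infinity of the proper rational functions. -/
noncomputable def properEval : properRing →ₐ[ℝ] ℝ :=
  AlgHom.ofLinearMap
    { toFun := fun f => valueAtInfinity f
      map_add' := fun f g => by
        have hf : f.1.denom.leadingCoeff ≠ 0 := leadingCoeff_ne_zero.2 f.1.denom_ne_zero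
        have hg : g.1.denom.leadingCoeff ≠ 0 := leadingCoeff_ne_zero.2 g.1.denom_ne_zero
        change valueAtInfinity (f.1 + g.1) = _
        rw [valueAtInfinity_of_eq_div (mul_ne_zero f.1.denom_ne_zero g.1.denom_ne_zero)
          (add_eq_div f.1 g.1) (natDegree_add_num_le f.2 g.2),
          natDegree_mul f.1.denom_ne_zero g.1.denom_ne_zero, coeff_add,
          coeff_mul_add_eq_of_natDegree_le f.2 le_rfl, coeff_mul_add_eq_of_natDegree_le le_rfl g.2,
          leadingCoeff_mul, valueAtInfinity, valueAtInfinity, div_add_div _ _ hf hg]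
        rfl
      map_smul' := fun r f => by
        change valueAtInfinity (r • f.1) = r * valueAtInfinity f.1
        have h : r • f.1 = algebraMap _ _ (C r * f.1.num) / algebraMap _ _ f.1.denom := by
          rw [map_mul, mul_div_assoc, f.1.num_div_denom, Algebra.smul_def]
          rfl
        rw [valueAtInfinity_of_eq_div f.1.denom_ne_zero h
          ((natDegree_C_mul_le _ _).trans f.2), coeff_C_mul, mul_div_assoc]
        rfl }
    (by
      change valueAtInfinity 1 = 1
      simp [valueAtInfinity])
    (fun f g => by
      change valueAtInfinity (f.1 * g.1) = valueAtInfinity f.1 * valueAtInfinity g.1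
      rw [valueAtInfinity_of_eq_div (mul_ne_zero f.1.denom_ne_zero g.1.denom_ne_zero)
        (mul_eq_div f.1 g.1) (natDegree_mul_num_le f.2 g.2),
        natDegree_mul f.1.denom_ne_zero g.1.denom_ne_zero,
        coeff_mul_add_eq_of_natDegree_le f.2 g.2,
        leadingCoeff_mul, valueAtInfinity, valueAtInfinity, div_mul_div_comm])

/-- The algebra `RH∞` of proper real rational functions without poles in the closed right
half-plane. -/
noncomputable def stableRing : Subalgebra ℝ (RatFunc ℝ) :=
  properRing ⊓ ⨅ s : {s : ℂ // 0 ≤ s.re}, regularAt s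

theorem mem_stableRing {f : RatFunc ℝ} :
    f ∈ stableRing ↔ IsProper f ∧ ∀ s : ℂ, 0 ≤ s.re → ¬ IsPole f s := by
  rw [stableRing, Algebra.mem_inf, Algebra.mem_iInf, Subtype.forall]
  rfl

theorem stableRing_le_regularAt {s : ℂ} (hs : 0 ≤ s.re) : stableRing ≤ regularAt s :=
  fun _ hf => (mem_stableRing.1 hf).2 s hs

theorem stableRing_le_properRing : stableRing ≤ properRing :=
  fun _ hf => (mem_stableRing.1 hf).1

/-- Evaluation of the functions in `RH∞` at a point of the closed right half-plane. -/
noncomputable def stableEval {s : ℂ} (hs : 0 ≤ s.re) : stableRing →ₐ[ℝ] ℂ :=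
  (regularEval s).comp (Subalgebra.inclusion (stableRing_le_regularAt hs))

/-- Evaluation of the functions in `RH∞` at infinity. -/
noncomputable def stableEvalInfinity : stableRing →ₐ[ℝ] ℝ :=
  properEval.comp (Subalgebra.inclusion stableRing_le_properRing)

theorem stableEval_apply {s : ℂ} (hs : 0 ≤ s.re) (f : stableRing) :
    stableEval hs f = aeval s f.1.num / aeval s f.1.denom := rfl

theorem stableEvalInfinity_apply (f : stableRing) :
    stableEvalInfinity f = valueAtInfinity f := rfl

/-- A function in `RH∞` without zeros in the closed right half-plane and at infinity is a unit. -/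
theorem isUnit_of_eval_ne_zero (f : stableRing)
    (hs : ∀ (s : ℂ) (hs : 0 ≤ s.re), stableEval hs f ≠ 0) (hinf : stableEvalInfinity f ≠ 0) :
    IsUnit f := by
  have hf0 : f.1 ≠ 0 := by
    intro h
    refine hinf ?_
    rw [show f = 0 from Subtype.ext h, map_zero]
  have hn0 : f.1.num ≠ 0 := RatFunc.num_ne_zero hf0
  have hinv : (f.1)⁻¹ = algebraMap _ _ f.1.denom / algebraMap _ _ f.1.num := by
    conv_lhs => rw [← f.1.num_div_denom, inv_div]
  have hmem : (f.1)⁻¹ ∈ stableRing := by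
    refine mem_stableRing.2 ⟨isProper_of_eq_div hn0 hinv ?_, fun s h hp => hs s h ?_⟩
    -- A nonzero value at infinity means that the numerator has degree at least that of the
    -- denominator, so the inverse is proper.
    · refine le_natDegree_of_ne_zero fun h => hinf ?_
      rw [stableEvalInfinity_apply, valueAtInfinity, h, zero_div]
    · have := eval₂_eq_zero_of_dvd_of_eval₂_eq_zero (algebraMap ℝ ℂ) s
        (RatFunc.denom_inv_dvd hf0) hp
      rw [stableEval_apply, aeval_def, this, zero_div]
  exact IsUnit.of_mul_eq_one ⟨_, hmem⟩ (Subtype.ext (mul_inv_cancel₀ hf0))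

/-- Finitely many functions in `RH∞` have a common denominator without zeros in the closed right
half-plane. -/
theorem exists_common_denominator (c : ℕ → stableRing) (m : ℕ) :
    ∃ (q : ℝ[X]) (p : ℕ → ℝ[X]), (∀ s : ℂ, 0 ≤ s.re → aeval s q ≠ 0) ∧
      ∀ k < m, (c k : RatFunc ℝ) = algebraMap _ _ (p k) / algebraMap _ _ q := by
  refine ⟨∏ k ∈ Finset.range m, (c k).1.denom,
    fun k => (c k).1.num * ∏ j ∈ (Finset.range m).erase k, (c j).1.denom, ?_, ?_⟩
  · intro s hs
    rw [map_prod]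
    exact Finset.prod_ne_zero_iff.2 fun k _ => (mem_stableRing.1 (c k).2).2 s hs
  · intro k hk
    have h := Finset.mul_prod_erase (Finset.range m) (fun j => (c j).1.denom)
      (Finset.mem_range.2 hk)
    rw [← h, map_mul, map_mul, mul_div_mul_right, RatFunc.num_div_denom]
    exact RatFunc.algebraMap_ne_zero (Finset.prod_ne_zero_iff.2 fun j _ => (c j).1.denom_ne_zero)

theorem eval_of_eq_div {s : ℂ} (hs : 0 ≤ s.re) (f : stableRing) {p q : ℝ[X]}
    (hq : aeval s q ≠ 0) (hf : (f : RatFunc ℝ) = algebraMap _ _ p / algebraMap _ _ q) :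
    stableEval hs f = aeval s p / aeval s q := by
  have hq0 : q ≠ 0 := by
    rintro rfl
    simp at hq
  have h := congrArg (aeval s) (num_mul_eq_mul_denom hq0 hf)
  rw [map_mul, map_mul] at h
  have hd : aeval s f.1.denom ≠ 0 := (mem_stableRing.1 f.2).2 s hs
  rw [stableEval_apply, div_eq_div_iff hd hq, h]

/-- Homotopy principle: a polynomial path in `RH∞` that starts at `1` and has no zero on the
imaginary axis (including infinity) has no zero in the closed right half-plane. -/
theorem eval_ne_zero_of_homotopy (F : stableRing[X]) (h0 : F.eval 0 = 1)
    (hinf : ∀ τ : ℝ, 0 < τ → τ ≤ 1 → stableEvalInfinity (F.eval (algebraMap ℝ _ τ)) ≠ 0)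
    (haxis : ∀ τ : ℝ, 0 < τ → τ ≤ 1 → ∀ (s : ℂ) (hs : 0 ≤ s.re), s.re = 0 → 0 ≤ s.im →
      stableEval hs (F.eval (algebraMap ℝ _ τ)) ≠ 0)
    {s : ℂ} (hs : 0 ≤ s.re) : stableEval hs (F.eval 1) ≠ 0 := by
  set m := F.natDegree + 1
  obtain ⟨q, p, hq, hp⟩ := exists_common_denominator F.coeff m
  have hq0 : q ≠ 0 := by
    rintro rfl
    exact hq 0 (by simp) (by simp)
  have hpq : ∀ k < m, (p k).natDegree ≤ q.natDegree := fun k hk =>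
    natDegree_le_of_isProper hq0 (hp k hk) (mem_stableRing.1 (F.coeff k).2).1
  set P : ℝ → ℝ[X] := fun τ => ∑ k ∈ Finset.range m, C (τ ^ k) * p k with hP
  have hFP : ∀ τ : ℝ, ((F.eval (algebraMap ℝ stableRing τ) : stableRing) : RatFunc ℝ) =
      algebraMap _ _ (P τ) / algebraMap _ _ q := by
    intro τ
    rw [eval_eq_sum_range, AddSubmonoidClass.coe_finsetSum, hP, map_sum, Finset.sum_div]
    refine Finset.sum_congr rfl fun k hk => ?_
    rw [map_mul, mul_div_assoc, ← hp k (Finset.mem_range.1 hk), mul_comm, ← map_pow]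
    rfl
  have hPq : ∀ τ, (P τ).natDegree ≤ q.natDegree := fun τ =>
    natDegree_sum_le_of_forall_le _ _ fun k hk =>
      (natDegree_C_mul_le _ _).trans (hpq k (Finset.mem_range.1 hk))
  have heval0 : F.eval (algebraMap ℝ _ 0) = 1 := by rw [map_zero, h0]
  have hnz : ∀ {s : ℂ} (hs : 0 ≤ s.re) (τ : ℝ),
      stableEval hs (F.eval (algebraMap ℝ _ τ)) ≠ 0 ↔ aeval s (P τ) ≠ 0 := by
    intro s hs τ
    rw [eval_of_eq_div hs _ (hq s hs) (hFP τ), Ne, div_eq_zero_iff, or_iff_left (hq s hs)]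
  have hmain := aeval_ne_zero_of_path P q.natDegree ?_ ?_ ?_ ?_ 1 (by simp) s hs
  · have := (hnz hs 1).2 hmain
    rwa [map_one] at this
  · intro τ hτ
    -- The coefficient of `P τ` in degree `q.natDegree` is, up to a nonzero factor, the value at
    -- infinity.
    refine le_antisymm (hPq τ) (le_natDegree_of_ne_zero fun h => ?_)
    have hne : stableEvalInfinity (F.eval (algebraMap ℝ _ τ)) ≠ 0 := by
      rcases hτ.1.eq_or_lt with rfl | hpos
      · rw [heval0, map_one]
        exact one_ne_zero
      · exact hinf τ hpos hτ.2
    refine hne ?_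
    rw [stableEvalInfinity_apply, valueAtInfinity_of_eq_div hq0 (hFP τ) (hPq τ), h, zero_div]
  · intro k
    simp only [hP, finsetSum_coeff, coeff_C_mul]
    fun_prop
  · intro τ hτ z hz
    have hupper : ∀ w : ℂ, w.re = 0 → 0 ≤ w.im → aeval w (P τ) ≠ 0 := by
      intro w hw hw'
      rw [← hnz hw.ge τ]
      rcases hτ.1.eq_or_lt with rfl | hpos
      · rw [heval0, map_one]
        exact one_ne_zero
      · exact haxis τ hpos hτ.2 w hw.ge hw hw'
    rcases le_total 0 z.im with h | h
    · exact hupper z hz h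
    -- Real coefficients: the lower half of the axis follows by conjugation.
    · have := hupper ((starRingEnd ℂ) z) (by simpa using hz) (by simpa using h)
      rw [aeval_conj] at this
      simpa using this
  · intro z hz
    rw [← hnz hz 0, heval0, map_one]
    exact one_ne_zero

end Rational

/-! ### Rational matrices, shells and the closed loop -/

section Matrices

variable {n : Type*}

/-- A rational matrix without a pole at `s`, as a matrix over the functions regular at `s`. -/
noncomputable def toRegular {s : ℂ} (M : Matrix n n (RatFunc ℝ)) (hM : ∀ a b, ¬ IsPole (M a b) s) :
    Matrix n n (regularAt s) :=
  Matrix.of fun a b => ⟨M a b, hM a b⟩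

/-- At a pole `RatFunc.eval` returns the default value of division by zero and is not
multiplicative; without poles it is the ring homomorphism `regularEval`. -/
theorem evalAt_mul [Fintype n] {s : ℂ} {M M' : Matrix n n (RatFunc ℝ)}
    (hM : ∀ a b, ¬ IsPole (M a b) s)
    (hM' : ∀ a b, ¬ IsPole (M' a b) s) : evalAt (M * M') s = evalAt M s * evalAt M' s := by
  have h1 : M * M' = (toRegular M hM * toRegular M' hM').map (regularAt s).val := by
    rw [Matrix.map_mul]
    rfl
  have h2 := Matrix.map_mul (L := toRegular M hM) (M := toRegular M' hM') (f := regularEval s)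
  rw [h1]
  exact h2

theorem evalAt_one [DecidableEq n] (s : ℂ) : evalAt (1 : Matrix n n (RatFunc ℝ)) s = 1 :=
  Matrix.map_one _ (RatFunc.eval_zero _ _) (RatFunc.eval_one _ _)

/-- A stable rational matrix, as a matrix over `RH∞`. -/
noncomputable def toStable (M : Matrix n n (RatFunc ℝ)) (hM : IsStable M) :
    Matrix n n stableRing :=
  Matrix.of fun a b => ⟨M a b, mem_stableRing.2 (hM a b)⟩

/-- If the Davis-Wielandt shells of `A` and `B` are disjoint then `A - B` is invertible. -/
theorem det_sub_ne_zero_of_dwShell_inter_eq_empty [Fintype n] [DecidableEq n] {A B : Matrix n n ℂ}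
    (h : dwShell A ∩ dwShell B = ∅) : (A - B).det ≠ 0 := by
  intro hdet
  obtain ⟨x, hx, hAx⟩ := Matrix.exists_mulVec_eq_zero_iff.2 hdet
  have hx' : ‖WithLp.toLp 2 x‖ ≠ 0 := by
    rw [norm_ne_zero_iff]
    simpa using hx
  set y : n → ℂ := ((‖WithLp.toLp 2 x‖⁻¹ : ℝ) : ℂ) • x
  have hy : ‖WithLp.toLp 2 y‖ = 1 := by
    simp only [y, WithLp.toLp_smul, norm_smul, Complex.norm_real, norm_inv, norm_norm]
    exact inv_mul_cancel₀ hx'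
  have hAB : A.mulVec y = B.mulVec y := by
    rw [Matrix.sub_mulVec, sub_eq_zero] at hAx
    simp only [y, Matrix.mulVec_smul, hAx]
  have : (dotProduct (star y) (A.mulVec y), ‖WithLp.toLp 2 (A.mulVec y)‖ ^ 2) ∈
      dwShell A ∩ dwShell B := ⟨⟨y, hy, rfl⟩, ⟨y, hy, by rw [hAB]⟩⟩
  rw [h] at this
  exact this

theorem isStable_blockDiagonal {m o : Type*} [DecidableEq o] {M : o → Matrix m m (RatFunc ℝ)}
    (hM : ∀ k, IsStable (M k)) : IsStable (Matrix.blockDiagonal M) := by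
  intro a b
  rw [Matrix.blockDiagonal_apply]
  split_ifs
  · exact hM _ _ _
  · exact mem_stableRing.1 (zero_mem _)

/-- If `det (1 + τ Z C)` has no zero on the imaginary axis (including infinity) for `0 < τ ≤ 1`,
then the loop of the stable systems `Z` and `C` is stable. -/
theorem closedLoopStable_of_homotopy [Fintype n] [DecidableEq n] {Z C : Matrix n n (RatFunc ℝ)}
    (hZ : IsStable Z) (hC : IsStable C)
    (hinf : ∀ τ : ℝ, 0 < τ → τ ≤ 1 → (1 + τ • (evalAtInfinity Z * evalAtInfinity C)).det ≠ 0)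
    (haxis : ∀ τ : ℝ, 0 < τ → τ ≤ 1 → ∀ s : ℂ, s.re = 0 → 0 ≤ s.im →
      (1 + (τ : ℂ) • (evalAt Z s * evalAt C s)).det ≠ 0) :
    ClosedLoopStable Z C := by
  set Z' := toStable Z hZ
  set C' := toStable C hC
  set F : stableRing[X] := (1 + (X : stableRing[X]) • (Z' * C').map Polynomial.C).det with hF
  have hFeval : ∀ r : stableRing, F.eval r = (1 + r • (Z' * C')).det := by
    intro r
    rw [hF, ← coe_evalRingHom, RingHom.map_det]
    congr 1
    ext a b
    simp only [Matrix.map_apply, Matrix.add_apply, Matrix.smul_apply, Matrix.one_apply, smul_eq_mul,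
      RingHom.mapMatrix_apply, map_add, map_one, coe_evalRingHom, eval_mul, eval_X, eval_C]
  -- Algebra homomorphisms commute with determinants, so one identity serves both infinity and the
  -- finite points.
  have hmap : ∀ {B : Type} [CommRing B] [Algebra ℝ B] (φ : stableRing →ₐ[ℝ] B) (τ : ℝ),
      φ (F.eval (algebraMap ℝ _ τ)) =
        (1 + algebraMap ℝ B τ • (Z'.map φ * C'.map φ)).det := by
    intro B _ _ φ τ
    rw [hFeval, AlgHom.map_det]
    congr 1
    ext a b
    simp [Matrix.one_apply, apply_ite, Matrix.mul_apply]
  have hone : F.eval 1 = F.eval (algebraMap ℝ _ 1) := by rw [map_one]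
  have hevalInf : ∀ τ : ℝ, stableEvalInfinity (F.eval (algebraMap ℝ _ τ)) =
      (1 + τ • (evalAtInfinity Z * evalAtInfinity C)).det := fun τ => hmap _ τ
  have heval : ∀ (s : ℂ) (hs : 0 ≤ s.re) (τ : ℝ), stableEval hs (F.eval (algebraMap ℝ _ τ)) =
      (1 + (τ : ℂ) • (evalAt Z s * evalAt C s)).det := fun s hs τ => hmap (stableEval hs) τ
  have hne : ∀ (s : ℂ) (hs : 0 ≤ s.re), stableEval hs (F.eval 1) ≠ 0 := by
    intro s hs
    refine eval_ne_zero_of_homotopy F ?_ ?_ ?_ hs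
    · rw [hFeval]
      simp
    · intro τ h0 h1
      rw [hevalInf]
      exact hinf τ h0 h1
    · intro τ h0 h1 z hz hz' hz''
      rw [heval]
      exact haxis τ h0 h1 z hz' hz''
  have hunit : IsUnit (F.eval 1) := by
    refine isUnit_of_eval_ne_zero _ hne ?_
    rw [hone, hevalInf]
    exact hinf 1 one_pos le_rfl
  set L : Matrix (n ⊕ n) (n ⊕ n) stableRing := Matrix.fromBlocks 1 Z' (-C') 1
  have hL : IsUnit L.det := by
    -- Schur complement of the lower right identity block.
    rw [Matrix.det_fromBlocks_one₂₂, mul_neg, sub_neg_eq_add]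
    rwa [hFeval, one_smul] at hunit
  have hLmap : (stableRing.val : stableRing →+* RatFunc ℝ).mapMatrix L = loopMatrix Z C := by
    ext (a | a) (b | b)
    · simp [L, loopMatrix, Matrix.one_apply, apply_ite]
    · rfl
    · rfl
    · simp [L, loopMatrix, Matrix.one_apply, apply_ite]
  refine ⟨?_, ?_, ?_⟩
  · rw [← hLmap, ← RingHom.map_det]
    exact (hL.map _).ne_zero
  -- The inverse is already taken over `RH∞`, so its entries are stable.
  · have hinv : (loopMatrix Z C)⁻¹ =
        (stableRing.val : stableRing →+* RatFunc ℝ).mapMatrix L⁻¹ := by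
      refine Matrix.inv_eq_right_inv ?_
      rw [← hLmap, ← map_mul, Matrix.mul_nonsing_inv _ hL, map_one]
    rw [hinv]
    exact fun a b => mem_stableRing.1 (L⁻¹ a b).2
  · intro s hs
    have h := hne s hs
    rwa [hone, heval, Complex.ofReal_one, one_smul] at h

end Matrices

end Feedback

/-! ### Shell separation implies closed-loop stability -/

theorem proposition1 (N : ℕ)
    -- the converters' admittances, stable in open loop
    (YC : Fin N → Matrix (Fin 2) (Fin 2) (RatFunc ℝ))
    (hYC : ∀ k, Feedback.IsStable (YC k))
    -- the admittance of the network, with an inverse that is stable in open loop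
    (Ygrid : Matrix (Fin 2 × Fin N) (Fin 2 × Fin N) (RatFunc ℝ))
    (hdet : Ygrid.det ≠ 0)
    (hgrid : Feedback.IsStable Ygrid⁻¹)
    -- the matrices `Ygrid(jω)` are defined
    (hpole : ∀ ω : ℝ, 0 ≤ ω → ∀ a b, ¬ Feedback.IsPole (Ygrid a b) (Complex.I * ω))
    -- the loop with gain `τ` is well posed (at infinite frequency)
    (hwp : ∀ τ : ℝ, 0 < τ → τ ≤ 1 →
      (1 + τ • (Feedback.evalAtInfinity Ygrid⁻¹ *
        Feedback.evalAtInfinity (Matrix.blockDiagonal YC))).det ≠ 0)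
    -- separation of the Davis-Wielandt shells
    (hDW : ∀ ω : ℝ, 0 ≤ ω → ∀ τ : ℝ, 0 < τ → τ ≤ 1 →
      Feedback.dwShell (Feedback.evalAt (Matrix.blockDiagonal YC) (Complex.I * ω)) ∩
        Feedback.dwShell ((-(1 / (τ : ℂ))) • Feedback.evalAt Ygrid (Complex.I * ω)) = ∅) :
    Feedback.ClosedLoopStable Ygrid⁻¹ (Matrix.blockDiagonal YC) := by
  refine Feedback.closedLoopStable_of_homotopy hgrid (Feedback.isStable_blockDiagonal hYC) hwp ?_
  intro τ hτ0 hτ1 s hs him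
  have hsω : s = Complex.I * (s.im : ℝ) := by
    apply Complex.ext <;> simp [hs]
  have hτ : (τ : ℂ) ≠ 0 := by exact_mod_cast hτ0.ne'
  have hsep := Feedback.det_sub_ne_zero_of_dwShell_inter_eq_empty (hDW s.im him τ hτ0 hτ1)
  have hpole' := hpole s.im him
  rw [← hsω] at hsep hpole'
  -- Neither factor has a pole at `s`, so the rational identity can be evaluated there.
  have hZY : Feedback.evalAt Ygrid⁻¹ s * Feedback.evalAt Ygrid s = 1 := by
    rw [← Feedback.evalAt_mul (fun a b => (hgrid a b).2 s hs.ge) hpole',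
      Matrix.nonsing_inv_mul _ hdet.isUnit, Feedback.evalAt_one]
  set Z := Feedback.evalAt Ygrid⁻¹ s
  set Y := Feedback.evalAt Ygrid s
  set C := Feedback.evalAt (Matrix.blockDiagonal YC) s
  -- Since `Z * Y = 1`, the return difference is an invertible matrix times the difference
  -- controlled by the shells.
  have hfactor : 1 + (τ : ℂ) • (Z * C) = ((τ : ℂ) • Z) * (C - (-(1 / (τ : ℂ))) • Y) := by
    rw [mul_sub, Matrix.smul_mul, Matrix.smul_mul, Matrix.mul_smul, hZY, smul_smul]
    simp [hτ, add_comm]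
  rw [hfactor, Matrix.det_mul, Matrix.det_smul]
  refine mul_ne_zero (mul_ne_zero (pow_ne_zero _ hτ) ?_) hsep
  intro h
  have := congrArg Matrix.det hZY
  rw [Matrix.det_mul, h, zero_mul, Matrix.det_one] at this
  exact zero_ne_one this
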